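/- Let $\mathbb T$ be the unit circle with normalised Lebesgue measure, and let $H^2=\{f\in L^2(\mathbb T): \hat f(n)=0 \text{ for all } n<0\}$ be the Hardy space (identified with its space of boundary functions). A function $\theta\in H^2$ is called inner if $|\theta|=1$ almost everywhere on $\mathbb T$; its model space is $K_\theta^2=(\theta H^2)^\perp\cap H^2$. For $g\in L^\infty(\mathbb T)$ the truncated Toeplitz operator $A_g^\theta:K_\theta^2\to K_\theta^2$ is $A_g^\theta f=P_\theta(gf)$, where $P_\theta$ is the orthogonal projection of $L^2(\mathbb T)$ onto $K_\theta^2$. For a bounded operator $T$ on a complex Hilbert space, let $W(T)=\{\langle Tx,x\rangle:\langle x,x\rangle=1\}$ denote its numerical range; for a square matrix this is taken with respect to the Euclidean inner product. **Lemma.** For every $3\times3$ complex matrix $A$ there exist an inner function $\theta$ with $K_\theta^2$ finite-dimensional and symbols $g_1,g_2\in L^\infty(\mathbb T)$ such that $$W(A)=W\bigl(A^\theta_{g_1}\oplus A^\theta_{g_2}\bigr),$$ where $A^\theta_{g_1}\oplus A^\theta_{g_2}$ is the orthogonal direct sum acting on $K_\theta^2\oplus K_\theta^2$. -/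

import Mathlib

open MeasureTheory AddCircle
open scoped ENNReal InnerProductSpace

noncomputable section

/-- The numerical range `{⟨T x, x⟩ : ⟨x, x⟩ = 1}` of a bounded operator. Mathlib's inner product is
conjugate-linear in its first argument, so `⟨T x, x⟩` (linear in `T x`) is `inner ℂ x (T x)`. -/
def numericalRange {E : Type*} [NormedAddCommGroup E] [InnerProductSpace ℂ E]
    (T : E →L[ℂ] E) : Set ℂ :=
  {w : ℂ | ∃ x : E, inner ℂ x x = 1 ∧ inner ℂ x (T x) = w}

/-- The orthogonal direct sum of two operators, `(x, y) ↦ (T₁ x, T₂ y)` on the Hilbert space direct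
sum `E ⊕ F`. -/
def opDirectSum {E F : Type*} [NormedAddCommGroup E] [InnerProductSpace ℂ E]
    [NormedAddCommGroup F] [InnerProductSpace ℂ F] (T₁ : E →L[ℂ] E) (T₂ : F →L[ℂ] F) :
    WithLp 2 (E × F) →L[ℂ] WithLp 2 (E × F) :=
  (WithLp.prodContinuousLinearEquiv 2 ℂ E F).symm.toContinuousLinearMap ∘L
    (T₁.prodMap T₂) ∘L (WithLp.prodContinuousLinearEquiv 2 ℂ E F).toContinuousLinearMap

/-- `L²(𝕋)` with respect to normalised Lebesgue measure; the circle is parametrised by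
`x ↦ exp (2 π i x)`, `x ∈ ℝ / ℤ`. -/
abbrev L2Circle : Type := Lp ℂ 2 (haarAddCircle : Measure UnitAddCircle)

/-- `L^∞(𝕋)`. -/
abbrev LinftyCircle : Type := Lp ℂ ∞ (haarAddCircle : Measure UnitAddCircle)

/-- The Hardy space `H²`, as the space of boundary functions in `L²(𝕋)`: those functions all of
whose Fourier coefficients of negative index vanish. -/
def hardySpace : Submodule ℂ L2Circle where
  carrier := {f | ∀ n : ℤ, n < 0 → fourierCoeff f n = 0}
  zero_mem' n _ := by
    rw [← fourierBasis_repr]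
    simp
  add_mem' {f g} hf hg n hn := by
    have h1 := hf n hn
    have h2 := hg n hn
    rw [← fourierBasis_repr] at h1 h2 ⊢
    simp [h1, h2]
  smul_mem' c f hf n hn := by
    have h1 := hf n hn
    rw [← fourierBasis_repr] at h1 ⊢
    simp [h1]

theorem isClosed_hardySpace : IsClosed (hardySpace : Set L2Circle) := by
  have h : (hardySpace : Set L2Circle) =
      ⋂ n : ℤ, ⋂ _ : n < 0, {f : L2Circle | fourierBasis.repr f n = 0} := by
    ext f
    simp [hardySpace, fourierBasis_repr]
  rw [h]
  refine isClosed_iInter fun n => isClosed_iInter fun _ => isClosed_eq ?_ continuous_const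
  simp only [HilbertBasis.repr_apply_apply]
  fun_prop

/-- An inner function: an element of `H²` that is unimodular almost everywhere on `𝕋`. -/
def IsInner (θ : L2Circle) : Prop :=
  θ ∈ hardySpace ∧ ∀ᵐ x ∂(haarAddCircle : Measure UnitAddCircle), ‖θ x‖ = 1

/-- The set `θ H²` of all products `θ f`, `f ∈ H²`, that lie in `L²(𝕋)`
(all of them do if `θ` is inner). -/
def mulHardySpace (θ : L2Circle) : Submodule ℂ L2Circle where
  carrier := {h | ∃ f ∈ hardySpace, h =ᵐ[haarAddCircle] fun x => θ x * f x}
  zero_mem' := by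
    refine ⟨0, hardySpace.zero_mem, ?_⟩
    filter_upwards [Lp.coeFn_zero ℂ 2 (haarAddCircle : Measure UnitAddCircle)] with x hx
    rw [hx, Pi.zero_apply, mul_zero]
  add_mem' := by
    rintro h k ⟨f, hf, hf'⟩ ⟨g, hg, hg'⟩
    refine ⟨f + g, hardySpace.add_mem hf hg, ?_⟩
    filter_upwards [Lp.coeFn_add h k, Lp.coeFn_add f g, hf', hg'] with x h1 h2 h3 h4
    rw [h1, h2, Pi.add_apply, Pi.add_apply, h3, h4, mul_add]
  smul_mem' := by
    rintro c h ⟨f, hf, hf'⟩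
    refine ⟨c • f, hardySpace.smul_mem c hf, ?_⟩
    filter_upwards [Lp.coeFn_smul c h, Lp.coeFn_smul c f, hf'] with x h1 h2 h3
    rw [h1, h2, Pi.smul_apply, Pi.smul_apply, h3, smul_eq_mul, smul_eq_mul, mul_left_comm]

/-- The model space `K_θ² = (θ H²)ᗮ ∩ H²`. -/
def modelSpace (θ : L2Circle) : Submodule ℂ L2Circle :=
  (mulHardySpace θ)ᗮ ⊓ hardySpace

theorem isClosed_modelSpace (θ : L2Circle) : IsClosed (modelSpace θ : Set L2Circle) :=
  (Submodule.isClosed_orthogonal _).inter isClosed_hardySpace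

instance (θ : L2Circle) : CompleteSpace (modelSpace θ) :=
  (isClosed_modelSpace θ).completeSpace_coe

/-- Multiplication `f ↦ g f` by a bounded symbol `g` on `L²(𝕋)`. -/
def mulSymbol (g : LinftyCircle) : L2Circle →L[ℂ] L2Circle :=
  (ContinuousLinearMap.mul ℂ ℂ).holderL haarAddCircle ∞ 2 2 g

/-- The truncated Toeplitz operator `A_g^θ f = P_θ (g f)` on the model space `K_θ²`, where `P_θ` is
the orthogonal projection of `L²(𝕋)` onto `K_θ²`. -/
def truncatedToeplitz (θ : L2Circle) (g : LinftyCircle) : modelSpace θ →L[ℂ] modelSpace θ :=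
  (modelSpace θ).orthogonalProjectionOnto ∘L mulSymbol g ∘L (modelSpace θ).subtypeL

end

/-!
The inner function is always `θ = z³`, and both symbols are the same trigonometric polynomial. The
monomials `1, z, …, zⁿ⁻¹` are an orthonormal basis of the model space of `zⁿ`, in which the truncated
Toeplitz operators with trigonometric polynomial symbols are exactly the Toeplitz matrices
(`exists_symbol_of_toeplitz`). Since `W(T ⊕ T) = W(T)` by convexity
(`numericalRange_opDirectSum_self`), it remains to find, for each `3 × 3` matrix `A`, a Toeplitz
matrix with the same numerical range (`exists_toeplitz_numericalRange_eq`).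

The numerical range of a matrix is compact and, by the Toeplitz–Hausdorff theorem, convex. It is
therefore determined by its support function, hence by the characteristic polynomials of the
Hermitian matrices `u A + ū A*` (`numericalRange_eq_of_charpoly_eq`). After a unitary change of basis
the Hermitian part of `A` is diagonal, so `A` is a diagonal matrix plus `I * k` with `k` Hermitian of
zero diagonal. The polynomials depend on `k` only through two linear combinations of
`pⱼ = |kₗₘ|²` (`{j, l, m} = {0, 1, 2}`) and one combination of the `pⱼ` with
`s = Re (k₀₁ k₁₂ k₂₀)`. The triples `p` with the prescribed values contain a line, along which
`s² - p₀ p₁ p₂` is nonpositive at the starting point and nonnegative where the line leaves the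
positive octant. At a zero of this function `k` can be taken real, so `A` may be assumed complex
symmetric (`exists_real_diagReMatrix`).

A complex symmetric matrix `S` becomes persymmetric in a basis `(v + i w) / √2, f, (v - i w) / √2`
with `v, f, w` real orthonormal, and it is Toeplitz there as soon as `⟨S f, f⟩ = tr S / 3`
(`exists_unitary_conj_eq_toeplitz`). Such an `f` is a common zero of two traceless real quadratic
forms on `ℝ³`, one of them diagonal, and exists by another intermediate value argument
(`exists_common_zero`).
-/

/-! ### Numerical ranges and orthonormal bases -/

theorem numericalRange_eq_of_linearIsometryEquiv {E F : Type*} [NormedAddCommGroup E]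
    [InnerProductSpace ℂ E] [NormedAddCommGroup F] [InnerProductSpace ℂ F] (e : E ≃ₗᵢ[ℂ] F)
    (S : E →L[ℂ] E) (T : F →L[ℂ] F) (h : ∀ x, e (S x) = T (e x)) :
    numericalRange S = numericalRange T := by
  ext w
  constructor
  · rintro ⟨x, hx, rfl⟩
    exact ⟨e x, by rw [e.inner_map_map, hx], by rw [← h, e.inner_map_map]⟩
  · rintro ⟨y, hy, rfl⟩
    obtain ⟨x, rfl⟩ := e.surjective y
    exact ⟨x, by rw [← e.inner_map_map, hy], by rw [← h, e.inner_map_map]⟩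

theorem numericalRange_eq_toEuclideanCLM {E ι : Type*} [NormedAddCommGroup E]
    [InnerProductSpace ℂ E] [Fintype ι] [DecidableEq ι] (b : OrthonormalBasis ι ℂ E)
    (T : E →L[ℂ] E) (M : Matrix ι ι ℂ) (hM : ∀ i j, inner ℂ (b i) (T (b j)) = M i j) :
    numericalRange T = numericalRange (Matrix.toEuclideanCLM (n := ι) (𝕜 := ℂ) M) := by
  refine numericalRange_eq_of_linearIsometryEquiv b.repr _ _ fun x => ?_
  have key : (b.repr.toLinearEquiv.toLinearMap ∘ₗ T.toLinearMap) =
      (Matrix.toEuclideanCLM (n := ι) (𝕜 := ℂ) M).toLinearMap ∘ₗ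
        b.repr.toLinearEquiv.toLinearMap := by
    refine b.toBasis.ext fun j => ?_
    ext i
    simp [b.repr_apply_apply, hM]
  exact LinearMap.congr_fun key x

theorem numericalRange_conj_unitary {ι : Type*} [Fintype ι] [DecidableEq ι]
    (U M : Matrix ι ι ℂ) (hU : U ∈ Matrix.unitaryGroup ι ℂ) :
    numericalRange (Matrix.toEuclideanCLM (n := ι) (𝕜 := ℂ) (star U * M * U)) =
      numericalRange (Matrix.toEuclideanCLM (n := ι) (𝕜 := ℂ) M) := by
  have hU' : Matrix.toEuclideanCLM (n := ι) (𝕜 := ℂ) U ∈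
      unitary (EuclideanSpace ℂ ι →L[ℂ] EuclideanSpace ℂ ι) := Unitary.map_mem _ hU
  refine numericalRange_eq_of_linearIsometryEquiv (Unitary.linearIsometryEquiv ⟨_, hU'⟩) _ _
    fun x => ?_
  have h : U * (star U * M * U) = M * U := by
    rw [← mul_assoc, ← mul_assoc, Matrix.mem_unitaryGroup_iff.mp hU, one_mul]
  have := congrArg (fun N => Matrix.toEuclideanCLM (n := ι) (𝕜 := ℂ) N x) h
  simp only [map_mul, mul_apply_eq_comp] at this ⊢
  exact this

/-! ### The model space of a monomial -/

theorem inner_fourierLp_eq_fourierCoeff (f : L2Circle) (k : ℤ) :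
    inner ℂ (fourierLp 2 k) f = fourierCoeff f k := by
  rw [← fourierBasis_repr, HilbertBasis.repr_apply_apply, coe_fourierBasis]

theorem fourierCoeff_fourierLp (k m : ℤ) :
    fourierCoeff (fourierLp 2 k : L2Circle) m = if m = k then 1 else 0 := by
  rw [← inner_fourierLp_eq_fourierCoeff]
  exact orthonormal_iff_ite.mp orthonormal_fourier m k

theorem fourierLp_mem_hardySpace {k : ℤ} (hk : 0 ≤ k) :
    (fourierLp 2 k : L2Circle) ∈ hardySpace := fun m hm => by
  rw [fourierCoeff_fourierLp, if_neg (by omega)]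

theorem isInner_fourierLp {k : ℤ} (hk : 0 ≤ k) : IsInner (fourierLp 2 k) := by
  refine ⟨fourierLp_mem_hardySpace hk, ?_⟩
  filter_upwards [coeFn_fourierLp (T := 1) 2 k] with x hx
  rw [hx, fourier_apply, Circle.norm_coe]

theorem fourierLp_mem_mulHardySpace {n k : ℤ} (h : n ≤ k) :
    (fourierLp 2 k : L2Circle) ∈ mulHardySpace (fourierLp 2 n) := by
  refine ⟨fourierLp 2 (k - n), fourierLp_mem_hardySpace (by omega), ?_⟩
  filter_upwards [coeFn_fourierLp (T := 1) 2 k, coeFn_fourierLp (T := 1) 2 n,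
    coeFn_fourierLp (T := 1) 2 (k - n)] with x h1 h2 h3
  rw [h1, h2, h3, ← fourier_add, add_sub_cancel]

/-- Functions in `zⁿ H²` have no Fourier coefficients below `n`. -/
theorem fourierCoeff_eq_zero_of_mem_mulHardySpace {n k : ℤ} (hk : k < n) {h : L2Circle}
    (hh : h ∈ mulHardySpace (fourierLp 2 n)) : fourierCoeff h k = 0 := by
  obtain ⟨f, hf, hhf⟩ := hh
  have h0 : fourierCoeff f (k - n) = 0 := hf _ (by omega)
  rw [← h0]
  refine integral_congr_ae ?_
  filter_upwards [hhf, coeFn_fourierLp (T := 1) 2 n] with x h1 h2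
  rw [h1, h2, show -(k - n) = -k + n by ring, fourier_add, smul_eq_mul, smul_eq_mul, mul_assoc]

theorem mem_modelSpace_fourierLp {n : ℤ} {f : L2Circle} :
    f ∈ modelSpace (fourierLp 2 n) ↔ ∀ k : ℤ, k < 0 ∨ n ≤ k → fourierCoeff f k = 0 := by
  constructor
  · rintro ⟨h1, h2⟩ k (hk | hk)
    · exact h2 k hk
    · rw [← inner_fourierLp_eq_fourierCoeff]
      exact (Submodule.mem_orthogonal _ _).mp h1 _ (fourierLp_mem_mulHardySpace hk)
  · refine fun h => ⟨(Submodule.mem_orthogonal _ _).mpr fun u hu => ?_, fun k hk => h k (.inl hk)⟩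
    rw [← fourierBasis.tsum_inner_mul_inner u f]
    refine (tsum_congr fun k => ?_).trans tsum_zero
    rw [coe_fourierBasis, inner_fourierLp_eq_fourierCoeff, ← inner_conj_symm,
      inner_fourierLp_eq_fourierCoeff]
    rcases lt_or_ge k n with hk | hk
    · rw [fourierCoeff_eq_zero_of_mem_mulHardySpace hk hu, map_zero, zero_mul]
    · rw [h k (.inr hk), mul_zero]

/-- The monomials `1, z, …, z^(n-1)` as elements of the model space of `z^n`. -/
noncomputable def modelMonomial (n : ℕ) (j : Fin n) : modelSpace (fourierLp 2 (n : ℤ)) :=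
  ⟨fourierLp 2 (j : ℤ), mem_modelSpace_fourierLp.mpr fun k hk => by
    rw [fourierCoeff_fourierLp, if_neg (by omega)]⟩

theorem orthonormal_modelMonomial (n : ℕ) : Orthonormal ℂ (modelMonomial n) := by
  have h : Orthonormal ℂ fun j : Fin n => (fourierLp 2 (j : ℤ) : L2Circle) :=
    orthonormal_fourier.comp (fun j : Fin n => (j : ℤ)) fun i j hij => Fin.ext (by simpa using hij)
  exact (Submodule.subtypeₗᵢ (modelSpace (fourierLp 2 (n : ℤ)))).orthonormal_comp_iff.mp h

theorem span_modelMonomial (n : ℕ) :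
    ⊤ ≤ Submodule.span ℂ (Set.range (modelMonomial n)) := by
  rintro ⟨f, hf⟩ -
  have hsum : f = ∑ j : Fin n, fourierCoeff f (j : ℤ) • (fourierLp 2 (j : ℤ) : L2Circle) := by
    have h0 : ∀ k ∉ Finset.univ.map ⟨fun j : Fin n => (j : ℤ), fun i j hij =>
        Fin.ext (by simpa using hij)⟩, fourierCoeff f k • (fourierLp 2 k : L2Circle) = 0 := by
      intro k hk
      rw [mem_modelSpace_fourierLp.mp hf k, zero_smul]
      by_contra! hc
      refine hk (Finset.mem_map.mpr ⟨⟨k.toNat, by omega⟩, Finset.mem_univ _, ?_⟩)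
      exact Int.toNat_of_nonneg hc.1
    have := (hasSum_fourier_series_L2 f).unique (hasSum_sum_of_ne_finset_zero h0)
    rwa [Finset.sum_map] at this
  have : (⟨f, hf⟩ : modelSpace (fourierLp 2 (n : ℤ))) =
      ∑ j : Fin n, fourierCoeff f (j : ℤ) • modelMonomial n j := by
    apply Subtype.ext
    rw [Submodule.coe_sum]
    exact hsum
  rw [this]
  exact Submodule.sum_mem _ fun j _ =>
    Submodule.smul_mem _ _ (Submodule.subset_span (Set.mem_range_self j))

/-- The monomials `1, z, …, z^(n-1)` as an orthonormal basis of the model space of `z^n`. -/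
noncomputable def modelBasis (n : ℕ) :
    OrthonormalBasis (Fin n) ℂ (modelSpace (fourierLp 2 (n : ℤ))) :=
  OrthonormalBasis.mk (orthonormal_modelMonomial n) (span_modelMonomial n)

theorem coe_modelBasis (n : ℕ) (j : Fin n) :
    (modelBasis n j : L2Circle) = fourierLp 2 (j : ℤ) := by
  simp [modelBasis, modelMonomial]

theorem mulSymbol_fourierLp (m k : ℤ) :
    mulSymbol (fourierLp ∞ m) (fourierLp 2 k) = fourierLp 2 (m + k) := by
  apply Lp.ext
  refine ((ContinuousLinearMap.mul ℂ ℂ).coeFn_holder _ _).trans ?_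
  filter_upwards [coeFn_fourierLp (T := 1) ∞ m, coeFn_fourierLp (T := 1) 2 k,
    coeFn_fourierLp (T := 1) 2 (m + k)] with x h1 h2 h3
  rw [h1, h2, h3, fourier_add, ContinuousLinearMap.mul_apply']

/-- Every Toeplitz matrix is the matrix of a truncated Toeplitz operator on the model space of
`z^n`, whose symbol is the trigonometric polynomial with the entries as coefficients. -/
theorem exists_symbol_of_toeplitz (n : ℕ) (c : ℤ → ℂ) :
    ∃ g : LinftyCircle, numericalRange (truncatedToeplitz (fourierLp 2 (n : ℤ)) g) =
      numericalRange (Matrix.toEuclideanCLM (n := Fin n) (𝕜 := ℂ)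
        (Matrix.of fun i j => c ((i : ℤ) - j))) := by
  refine ⟨∑ k ∈ Finset.Icc (-n : ℤ) n, c k • fourierLp ∞ k,
    numericalRange_eq_toEuclideanCLM (modelBasis n) _ _ fun i j => ?_⟩
  have hm : mulSymbol (∑ k ∈ Finset.Icc (-n : ℤ) n, c k • fourierLp ∞ k) (fourierLp 2 (j : ℤ)) =
      ∑ k ∈ Finset.Icc (-n : ℤ) n, c k • (fourierLp 2 (k + j) : L2Circle) := by
    simp only [← mulSymbol_fourierLp]
    simp [mulSymbol]
  have : inner ℂ (modelBasis n i) (truncatedToeplitz (fourierLp 2 (n : ℤ))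
      (∑ k ∈ Finset.Icc (-n : ℤ) n, c k • fourierLp ∞ k) (modelBasis n j)) =
      inner ℂ (modelBasis n i : L2Circle)
        (mulSymbol (∑ k ∈ Finset.Icc (-n : ℤ) n, c k • fourierLp ∞ k) (modelBasis n j)) :=
    Submodule.inner_orthogonalProjectionOnto_eq_of_mem_left _ _
  rw [this, coe_modelBasis, coe_modelBasis, hm, inner_sum]
  simp only [inner_smul_right, inner_fourierLp_eq_fourierCoeff, fourierCoeff_fourierLp]
  rw [Finset.sum_eq_single ((i : ℤ) - j)]
  · simp
  · intro k _ hk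
    rw [if_neg (by omega), mul_zero]
  · intro h
    exact absurd (Finset.mem_Icc.mpr ⟨by omega, by omega⟩) h

/-! ### Convexity and compactness of the numerical range -/

section

variable {E : Type*} [NormedAddCommGroup E] [InnerProductSpace ℂ E]

theorem inner_self_eq_ofReal (x : E) : (inner ℂ x x : ℂ) = ((‖x‖ ^ 2 : ℝ) : ℂ) := by
  rw [inner_self_eq_norm_sq_to_K, Complex.ofReal_pow]
  rfl

theorem inner_self_eq_one_iff_norm {x : E} : (inner ℂ x x : ℂ) = 1 ↔ ‖x‖ = 1 := by
  rw [inner_self_eq_ofReal, Complex.ofReal_eq_one,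
    pow_eq_one_iff_of_nonneg (norm_nonneg _) two_ne_zero]

theorem mem_numericalRange_of_eq_mul {T : E →L[ℂ] E} {w : ℂ} {x : E} (hx : x ≠ 0)
    (h : inner ℂ x (T x) = w * inner ℂ x x) : w ∈ numericalRange T := by
  have hn : (‖x‖ : ℂ) ≠ 0 := by simpa using hx
  have hxx : (inner ℂ x x : ℂ) = ‖x‖ ^ 2 := inner_self_eq_norm_sq_to_K x
  refine ⟨(‖x‖⁻¹ : ℂ) • x, ?_, ?_⟩
  · rw [inner_smul_left, inner_smul_right, hxx]
    simp
    field_simp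
  · rw [map_smul, inner_smul_left, inner_smul_right, h, hxx]
    simp
    field_simp

/-- The Toeplitz–Hausdorff theorem for a segment with end points `0` and `1`; replacing `T` by
`a T + b` reduces the general case to this one. -/
theorem ofReal_mem_numericalRange {T : E →L[ℂ] E} (h0 : 0 ∈ numericalRange T)
    (h1 : 1 ∈ numericalRange T) {s : ℝ} (hs : s ∈ Set.Icc (0 : ℝ) 1) :
    (s : ℂ) ∈ numericalRange T := by
  obtain ⟨x, hx, hx0⟩ := h0
  obtain ⟨y, hy, hy1⟩ := h1
  -- After rotating `y` by a phase `u`, the values of the form on the real span of `x`, `y` are real.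
  obtain ⟨u, hu, him⟩ : ∃ u : ℂ, ‖u‖ = 1 ∧
      (u * inner ℂ x (T y) + (starRingEnd ℂ) u * inner ℂ y (T x)).im = 0 := by
    -- The imaginary part is that of `u * p`, so `u = p̄ / |p|` works.
    set p : ℂ := inner ℂ x (T y) - (starRingEnd ℂ) (inner ℂ y (T x)) with hp
    have key : ∀ u : ℂ, (u * inner ℂ x (T y) + (starRingEnd ℂ) u * inner ℂ y (T x)).im =
        (u * p).im := by
      intro u
      simp only [hp, mul_sub, Complex.sub_im, Complex.add_im, Complex.mul_im, Complex.conj_re,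
        Complex.conj_im]
      ring
    by_cases hp0 : p = 0
    · exact ⟨1, by simp, by rw [key, hp0]; simp⟩
    · have hn : (‖p‖ : ℂ) ≠ 0 := by simpa using hp0
      refine ⟨(starRingEnd ℂ) p / ‖p‖, ?_, ?_⟩
      · rw [norm_div, RCLike.norm_conj, Complex.norm_real, norm_norm, div_self (by simpa using hp0)]
      · rw [key, div_mul_eq_mul_div, mul_comm, Complex.mul_conj, Complex.normSq_eq_norm_sq,
          ← Complex.ofReal_div, Complex.ofReal_im]
  have huu : (starRingEnd ℂ) u * u = 1 := by
    rw [mul_comm, Complex.mul_conj, Complex.normSq_eq_norm_sq, hu]; simp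
  set z : ℝ → E := fun t => ((1 - t : ℝ) : ℂ) • x + ((t : ℝ) : ℂ) • u • y with hz
  have hzne : ∀ t, z t ≠ 0 := by
    intro t ht
    -- Otherwise `(1 - t) x = -t u y`, where the form takes the values `0` and `t²`.
    have hxy : ((1 - t : ℝ) : ℂ) • x = (-((t : ℂ) * u)) • y := by
      rw [neg_smul, mul_smul]
      exact eq_neg_of_add_eq_zero_left ht
    have q0 : inner ℂ (((1 - t : ℝ) : ℂ) • x) (T (((1 - t : ℝ) : ℂ) • x)) = (0 : ℂ) := by
      rw [map_smul, inner_smul_left, inner_smul_right, hx0]; simp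
    have q1 : inner ℂ ((-((t : ℂ) * u)) • y) (T ((-((t : ℂ) * u)) • y)) = ((t ^ 2 : ℝ) : ℂ) := by
      rw [map_smul, inner_smul_left, inner_smul_right, hy1]
      simp only [map_neg, map_mul, Complex.conj_ofReal]
      push_cast
      linear_combination (t : ℂ) ^ 2 * huu
    rw [hxy, q1] at q0
    have ht0 : t = 0 := by
      have : t ^ 2 = 0 := by exact_mod_cast q0
      exact pow_eq_zero_iff (two_ne_zero) |>.mp this
    rw [ht0] at hxy
    have : x = 0 := by simpa using hxy
    rw [this] at hx
    simp at hx
  set N : ℝ → ℝ := fun t => ‖z t‖ ^ 2 with hN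
  set Q : ℝ → ℝ := fun t => (inner ℂ (z t) (T (z t)) : ℂ).re with hQ
  have hNpos : ∀ t, N t ≠ 0 := fun t => by simpa [hN] using hzne t
  have hzc : Continuous z := by fun_prop
  have hcont : Continuous fun t => Q t / N t := by
    refine Continuous.div ?_ (by fun_prop) hNpos
    exact Complex.continuous_re.comp (hzc.inner (T.continuous.comp hzc))
  have hQim : ∀ t, (inner ℂ (z t) (T (z t)) : ℂ) = Q t := by
    intro t
    apply Complex.ext
    · simp [hQ]
    · have : (inner ℂ (z t) (T (z t)) : ℂ) = ((t * (1 - t) : ℝ) : ℂ) *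
          (u * inner ℂ x (T y) + (starRingEnd ℂ) u * inner ℂ y (T x)) + ((t ^ 2 : ℝ) : ℂ) := by
        simp only [hz, map_add, map_smul, inner_add_left, inner_add_right, inner_smul_left,
          inner_smul_right, hx0, hy1, Complex.conj_ofReal]
        push_cast
        linear_combination (t : ℂ) ^ 2 * huu
      rw [this, Complex.add_im, Complex.im_ofReal_mul, him, Complex.ofReal_im, Complex.ofReal_im]
      simp
  have hz0 : z 0 = x := by simp [hz]
  have hz1 : z 1 = u • y := by simp [hz]
  have hv0 : Q 0 / N 0 = 0 := by simp [hQ, hz0, hx0]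
  have hv1 : Q 1 / N 1 = 1 := by
    have a1 : Q 1 = 1 := by
      simp only [hQ, hz1, map_smul, inner_smul_left, inner_smul_right, hy1]
      rw [mul_one, mul_comm, huu, Complex.one_re]
    have a2 : N 1 = 1 := by
      simp only [hN, hz1, norm_smul, hu, inner_self_eq_one_iff_norm.mp hy]; norm_num
    rw [a1, a2, div_one]
  obtain ⟨t, -, ht⟩ := intermediate_value_Icc zero_le_one hcont.continuousOn
    (show s ∈ Set.Icc (Q 0 / N 0) (Q 1 / N 1) by rwa [hv0, hv1])
  refine mem_numericalRange_of_eq_mul (hzne t) ?_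
  rw [hQim, inner_self_eq_ofReal, ← ht, ← Complex.ofReal_mul]
  exact congrArg _ (div_mul_cancel₀ _ (hNpos t)).symm

theorem mem_numericalRange_smul_add {T : E →L[ℂ] E} {a b w : ℂ} (hw : w ∈ numericalRange T) :
    a * w + b ∈ numericalRange (a • T + b • ContinuousLinearMap.id ℂ E) := by
  obtain ⟨x, hx, rfl⟩ := hw
  refine ⟨x, hx, ?_⟩
  rw [add_apply, smul_apply, smul_apply, ContinuousLinearMap.id_apply, inner_add_right,
    inner_smul_right, inner_smul_right, hx, mul_one]

/-- The **Toeplitz–Hausdorff theorem**. -/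
theorem convex_numericalRange (T : E →L[ℂ] E) : Convex ℝ (numericalRange T) := by
  intro w₀ h₀ w₁ h₁ r s hr hs hrs
  by_cases h : w₀ = w₁
  · subst h
    rwa [← add_smul, hrs, one_smul]
  have hd : w₁ - w₀ ≠ 0 := sub_ne_zero.mpr (Ne.symm h)
  set S : E →L[ℂ] E := (w₁ - w₀)⁻¹ • T + (-(w₁ - w₀)⁻¹ * w₀) • ContinuousLinearMap.id ℂ E with hS
  have hS0 : 0 ∈ numericalRange S := by
    have := mem_numericalRange_smul_add (a := (w₁ - w₀)⁻¹) (b := -(w₁ - w₀)⁻¹ * w₀) h₀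
    rwa [show (w₁ - w₀)⁻¹ * w₀ + -(w₁ - w₀)⁻¹ * w₀ = 0 by ring] at this
  have hS1 : 1 ∈ numericalRange S := by
    have := mem_numericalRange_smul_add (a := (w₁ - w₀)⁻¹) (b := -(w₁ - w₀)⁻¹ * w₀) h₁
    rwa [show (w₁ - w₀)⁻¹ * w₁ + -(w₁ - w₀)⁻¹ * w₀ = 1 by field_simp; ring] at this
  have hs' := mem_numericalRange_smul_add (a := w₁ - w₀) (b := w₀)
    (ofReal_mem_numericalRange hS0 hS1 (s := s) ⟨hs, by linarith⟩)
  have hT : (w₁ - w₀) • S + w₀ • ContinuousLinearMap.id ℂ E = T := by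
    ext x
    simp only [hS, add_apply, smul_apply,
      ContinuousLinearMap.id_apply, smul_add, smul_smul]
    rw [mul_inv_cancel₀ hd, one_smul, add_assoc, ← add_smul]
    field_simp
    simp
  rw [hT] at hs'
  convert hs' using 1
  have : (r : ℂ) = 1 - s := by rw [← Complex.ofReal_one, ← hrs]; push_cast; ring
  simp only [Complex.real_smul, this]
  ring

theorem isCompact_numericalRange [FiniteDimensional ℂ E] (T : E →L[ℂ] E) :
    IsCompact (numericalRange T) := by
  have : ProperSpace E := FiniteDimensional.proper ℂ E
  have h : numericalRange T = (fun x : E => (inner ℂ x (T x) : ℂ)) '' Metric.sphere 0 1 := by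
    ext w
    simp only [numericalRange, inner_self_eq_one_iff_norm, Set.mem_ofPred_eq, Set.mem_image,
      mem_sphere_zero_iff_norm]
  rw [h]
  exact (isCompact_sphere 0 1).image (continuous_id.inner T.continuous)

/-- A unit vector `(x, y)` gives a convex combination of values at `x / ‖x‖` and `y / ‖y‖`. -/
theorem numericalRange_opDirectSum_self (T : E →L[ℂ] E) :
    numericalRange (opDirectSum T T) = numericalRange T := by
  ext w
  constructor
  · rintro ⟨v, hv, rfl⟩
    have e1 : (inner ℂ v (opDirectSum T T v) : ℂ) =
        inner ℂ v.fst (T v.fst) + inner ℂ v.snd (T v.snd) := by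
      rw [WithLp.prod_inner_apply]; rfl
    have hv' : ‖v.fst‖ ^ 2 + ‖v.snd‖ ^ 2 = 1 := by
      rw [WithLp.prod_inner_apply, inner_self_eq_ofReal, inner_self_eq_ofReal] at hv
      exact_mod_cast hv
    rw [e1]
    -- Each component contributes its squared norm times a point of the numerical range.
    have key : ∀ x : E, x ≠ 0 → ∃ w ∈ numericalRange T,
        (inner ℂ x (T x) : ℂ) = (‖x‖ ^ 2 : ℝ) • w := by
      intro x hx
      have hn : (inner ℂ x x : ℂ) ≠ 0 := by simpa using hx
      refine ⟨inner ℂ x (T x) / inner ℂ x x,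
        mem_numericalRange_of_eq_mul hx (div_mul_cancel₀ _ hn).symm, ?_⟩
      rw [Complex.real_smul, ← inner_self_eq_ofReal, mul_div_cancel₀ _ hn]
    by_cases h1 : v.fst = 0
    · rw [h1] at hv' ⊢
      obtain ⟨w, hw, h⟩ := key v.snd (by rintro h; rw [h] at hv'; simp at hv')
      have : ‖v.snd‖ ^ 2 = 1 := by simpa using hv'
      rw [h, this]; simpa using hw
    by_cases h2 : v.snd = 0
    · rw [h2] at hv' ⊢
      obtain ⟨w, hw, h⟩ := key v.fst h1
      have : ‖v.fst‖ ^ 2 = 1 := by simpa using hv'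
      rw [h, this]; simpa using hw
    obtain ⟨w, hw, h⟩ := key v.fst h1
    obtain ⟨w', hw', h'⟩ := key v.snd h2
    rw [h, h']
    exact convex_numericalRange T hw hw' (by positivity) (by positivity) hv'
  · rintro ⟨x, hx, rfl⟩
    refine ⟨WithLp.toLp 2 (x, 0), ?_, ?_⟩
    · rw [WithLp.prod_inner_apply]; simpa using hx
    · rw [WithLp.prod_inner_apply]
      simp [opDirectSum]

end

/-! ### The numerical range is determined by characteristic polynomials -/

theorem isHermitian_smul_add_conjTranspose {ι : Type*} (u : ℂ) (M : Matrix ι ι ℂ) :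
    (u • M + star u • M.conjTranspose).IsHermitian := by
  rw [Matrix.IsHermitian, Matrix.conjTranspose_add, Matrix.conjTranspose_smul,
    Matrix.conjTranspose_smul, star_star, Matrix.conjTranspose_conjTranspose, add_comm]

section

variable {ι : Type*} [Fintype ι] [DecidableEq ι]

/-- Hermitian matrices with equal characteristic polynomials are unitarily similar to the same
diagonal matrix. -/
theorem Matrix.IsHermitian.numericalRange_eq_of_charpoly_eq {G H : Matrix ι ι ℂ}
    (hG : G.IsHermitian) (hH : H.IsHermitian) (h : G.charpoly = H.charpoly) :
    numericalRange (Matrix.toEuclideanCLM (n := ι) (𝕜 := ℂ) G) =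
      numericalRange (Matrix.toEuclideanCLM (n := ι) (𝕜 := ℂ) H) := by
  have key : ∀ {N : Matrix ι ι ℂ} (hN : N.IsHermitian),
      numericalRange (Matrix.toEuclideanCLM (n := ι) (𝕜 := ℂ)
        (Matrix.diagonal (RCLike.ofReal ∘ hN.eigenvalues))) =
      numericalRange (Matrix.toEuclideanCLM (n := ι) (𝕜 := ℂ) N) := by
    intro N hN
    rw [← hN.conjStarAlgAut_star_eigenvectorUnitary, Unitary.conjStarAlgAut_star_apply]
    exact numericalRange_conj_unitary _ _ hN.eigenvectorUnitary.2
  rw [← key hG, ← key hH, (hG.eigenvalues_eq_eigenvalues_iff hH).mpr h]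

/-- The quadratic form of `u M + ū M*` is `2 Re (u ⟨M x, x⟩)`. -/
theorem inner_smul_add_conjTranspose (u : ℂ) (M : Matrix ι ι ℂ) (x : EuclideanSpace ℂ ι) :
    inner ℂ x (Matrix.toEuclideanCLM (n := ι) (𝕜 := ℂ) (u • M + star u • M.conjTranspose) x) =
      ((2 * (u * inner ℂ x (Matrix.toEuclideanCLM (n := ι) (𝕜 := ℂ) M x)).re : ℝ) : ℂ) := by
  have hstar : Matrix.toEuclideanCLM (n := ι) (𝕜 := ℂ) M.conjTranspose =
      ContinuousLinearMap.adjoint (Matrix.toEuclideanCLM (n := ι) (𝕜 := ℂ) M) := by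
    rw [← Matrix.star_eq_conjTranspose, map_star, ContinuousLinearMap.star_eq_adjoint]
  rw [map_add, map_smul, map_smul, hstar, add_apply, smul_apply, smul_apply, inner_add_right,
    inner_smul_right, inner_smul_right, ContinuousLinearMap.adjoint_inner_right,
    ← inner_conj_symm (Matrix.toEuclideanCLM (n := ι) (𝕜 := ℂ) M x) x]
  have := Complex.add_conj (u * inner ℂ x (Matrix.toEuclideanCLM (n := ι) (𝕜 := ℂ) M x))
  rw [map_mul] at this
  exact this

/-- The support function of the closed convex set `W(M)` in the direction `u` is half the largest
eigenvalue of `u M + ū M*`, so these characteristic polynomials determine `W(M)`. -/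
theorem numericalRange_subset_of_charpoly_eq {M N : Matrix ι ι ℂ}
    (h : ∀ u : ℂ, (u • M + star u • M.conjTranspose).charpoly =
      (u • N + star u • N.conjTranspose).charpoly) :
    numericalRange (Matrix.toEuclideanCLM (n := ι) (𝕜 := ℂ) N) ⊆
      numericalRange (Matrix.toEuclideanCLM (n := ι) (𝕜 := ℂ) M) := by
  intro w hw
  by_contra hwM
  obtain ⟨f, c, hf, hc⟩ := RCLike.geometric_hahn_banach_closed_point (𝕜 := ℂ)
    (convex_numericalRange (Matrix.toEuclideanCLM (n := ι) (𝕜 := ℂ) M))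
    (isCompact_numericalRange _).isClosed hwM
  have hfz : ∀ z, f z = f 1 * z := fun z => by
    conv_lhs => rw [← mul_one z, ← smul_eq_mul, map_smul, smul_eq_mul, mul_comm]
  obtain ⟨x, hx, rfl⟩ := hw
  have hmem : inner ℂ x (Matrix.toEuclideanCLM (n := ι) (𝕜 := ℂ)
      (f 1 • N + star (f 1) • N.conjTranspose) x) ∈ numericalRange
      (Matrix.toEuclideanCLM (n := ι) (𝕜 := ℂ) (f 1 • N + star (f 1) • N.conjTranspose)) :=
    ⟨x, hx, rfl⟩
  rw [← (isHermitian_smul_add_conjTranspose _ _).numericalRange_eq_of_charpoly_eq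
    (isHermitian_smul_add_conjTranspose _ _) (h (f 1))] at hmem
  obtain ⟨y, hy, hxy⟩ := hmem
  rw [inner_smul_add_conjTranspose, inner_smul_add_conjTranspose, Complex.ofReal_inj,
    ← hfz, ← hfz] at hxy
  have h1 := hf _ ⟨y, hy, rfl⟩
  simp only [RCLike.re_to_complex] at h1 hc
  linarith

theorem numericalRange_eq_of_charpoly_eq {M N : Matrix ι ι ℂ}
    (h : ∀ u : ℂ, (u • M + star u • M.conjTranspose).charpoly =
      (u • N + star u • N.conjTranspose).charpoly) :
    numericalRange (Matrix.toEuclideanCLM (n := ι) (𝕜 := ℂ) M) =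
      numericalRange (Matrix.toEuclideanCLM (n := ι) (𝕜 := ℂ) N) :=
  (numericalRange_subset_of_charpoly_eq fun u => (h u).symm).antisymm
    (numericalRange_subset_of_charpoly_eq h)

end

/-! ### Complex symmetric matrices with the same numerical range -/

/-- The direction `d` of a line of triples `p` along which `∑ pⱼ` and `∑ aⱼ pⱼ` are constant,
and which leaves the positive octant. -/
theorem exists_neg_sum_eq_zero_sum_mul_eq_zero (a : Fin 3 → ℝ) :
    ∃ d : Fin 3 → ℝ, (∃ j, d j < 0) ∧ ∑ j, d j = 0 ∧ ∑ j, a j * d j = 0 := by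
  by_cases h : a 0 = a 1 ∧ a 1 = a 2
  · exact ⟨![-1, 1, 0], ⟨0, by simp⟩, by simp [Fin.sum_univ_three],
      by simp [Fin.sum_univ_three, h.1]⟩
  · refine ⟨![a 1 - a 2, a 2 - a 0, a 0 - a 1], ?_, by simp [Fin.sum_univ_three],
      by simp [Fin.sum_univ_three]; ring⟩
    by_contra! hc
    have h0 := hc 0
    have h1 := hc 1
    have h2 := hc 2
    simp only [Matrix.cons_val] at h0 h1 h2
    exact h ⟨by linarith, by linarith⟩

/-- Moving `p` along a line until `s ^ 2 = p₀ p₁ p₂`: at the start `s ^ 2` is at most the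
product, and the product vanishes where the line leaves the positive octant. -/
theorem exists_sq_eq_prod {p d : Fin 3 → ℝ} {s : ℝ} (e : ℝ) (hp : ∀ j, 0 ≤ p j)
    (hd : ∃ j, d j < 0) (hs : s ^ 2 ≤ ∏ j, p j) :
    ∃ t : ℝ, (∀ j, 0 ≤ p j + t * d j) ∧ (s + t * e) ^ 2 = ∏ j, (p j + t * d j) := by
  set S : Set ℝ := {t | 0 ≤ t} ∩ (⋂ j, {t | 0 ≤ p j + t * d j}) ∩
    {t | (s + t * e) ^ 2 ≤ ∏ j, (p j + t * d j)} with hS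
  have hclosed : IsClosed S :=
    ((isClosed_le continuous_const continuous_id).inter
      (isClosed_iInter fun j => isClosed_le continuous_const (by fun_prop))).inter
      (isClosed_le (by fun_prop) (by fun_prop))
  obtain ⟨j₀, hj₀⟩ := hd
  have hsub : S ⊆ Set.Icc 0 (p j₀ / -d j₀) := by
    rintro t ⟨⟨h0, h1⟩, -⟩
    refine ⟨h0, ?_⟩
    have := Set.mem_iInter.mp h1 j₀
    simp only [Set.mem_ofPred_eq] at this
    rw [le_div_iff₀ (by linarith)]
    linarith
  have hne : S.Nonempty := ⟨0, ⟨le_refl (0 : ℝ), Set.mem_iInter.mpr fun j => by simpa using hp j⟩,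
    by simpa using hs⟩
  -- At the largest `t` with `s² ≤ p₀ p₁ p₂`, strict inequality would allow a larger `t`.
  obtain ⟨t, ⟨⟨ht0, ht1⟩, ht2⟩, hmax⟩ :=
    (isCompact_Icc.of_isClosed_subset hclosed hsub).exists_isGreatest hne
  have ht1' : ∀ j, 0 ≤ p j + t * d j := fun j => Set.mem_iInter.mp ht1 j
  refine ⟨t, ht1', ht2.antisymm (not_lt.mp fun hlt => ?_)⟩
  have hpos : ∀ j, 0 < p j + t * d j := by
    have hprod : 0 < ∏ j, (p j + t * d j) := (sq_nonneg _).trans_lt hlt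
    exact fun j => lt_of_le_of_ne (ht1' j) fun h =>
      hprod.ne' (Finset.prod_eq_zero (Finset.mem_univ j) h.symm)
  have hopen : IsOpen ((⋂ j, {t | 0 < p j + t * d j}) ∩
      {t | (s + t * e) ^ 2 < ∏ j, (p j + t * d j)}) :=
    (isOpen_iInter_of_finite fun j => isOpen_lt continuous_const (by fun_prop)).inter
      (isOpen_lt (by fun_prop) (by fun_prop))
  obtain ⟨ε, hε, hball⟩ := Metric.isOpen_iff.mp hopen t ⟨Set.mem_iInter.mpr hpos, hlt⟩
  have hmem : t + ε / 2 ∈ Metric.ball t ε := by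
    rw [Metric.mem_ball, Real.dist_eq, add_sub_cancel_left, abs_of_pos (by linarith)]
    linarith
  obtain ⟨h1, h2⟩ := hball hmem
  have hge := hmax (show t + ε / 2 ∈ S from ⟨⟨show 0 ≤ t + ε / 2 from add_nonneg ht0 (by linarith),
    Set.mem_iInter.mpr fun j =>
      (show 0 < p j + (t + ε / 2) * d j from Set.mem_iInter.mp h1 j).le⟩,
    (show (s + (t + ε / 2) * e) ^ 2 < ∏ j, (p j + (t + ε / 2) * d j) from h2).le⟩)
  linarith

theorem exists_sq_eq_mul_eq {p : Fin 3 → ℝ} {s : ℝ} (hp : ∀ j, 0 ≤ p j)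
    (hs : s ^ 2 = ∏ j, p j) : ∃ x : Fin 3 → ℝ, (∀ j, x j ^ 2 = p j) ∧ x 0 * x 1 * x 2 = s := by
  have h1 : (√(p 0) * √(p 1) * √(p 2)) ^ 2 = s ^ 2 := by
    rw [mul_pow, mul_pow, Real.sq_sqrt (hp 0), Real.sq_sqrt (hp 1), Real.sq_sqrt (hp 2), hs,
      Fin.prod_univ_three]
  rcases sq_eq_sq_iff_eq_or_eq_neg.mp h1 with h | h
  · exact ⟨fun j => √(p j), fun j => Real.sq_sqrt (hp j), h⟩
  · refine ⟨![√(p 0), √(p 1), -√(p 2)], fun j => ?_, ?_⟩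
    · fin_cases j <;> simp [Real.sq_sqrt, hp]
    · simp only [Matrix.cons_val]
      linarith

/-- The matrix with diagonal `m` and off-diagonal part `I * k`, where `k` is Hermitian with
`k₁₂ = κ 0`, `k₂₀ = κ 1`, `k₀₁ = κ 2`. These are the matrices whose Hermitian part is diagonal; they
are complex symmetric when `κ` is real. -/
noncomputable def diagReMatrix (m κ : Fin 3 → ℂ) : Matrix (Fin 3) (Fin 3) ℂ :=
  !![m 0, Complex.I * κ 2, Complex.I * star (κ 1);
    Complex.I * star (κ 2), m 1, Complex.I * κ 0;
    Complex.I * κ 1, Complex.I * star (κ 0), m 2]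

theorem exists_unitary_conj_eq_diagReMatrix (A : Matrix (Fin 3) (Fin 3) ℂ) :
    ∃ U ∈ Matrix.unitaryGroup (Fin 3) ℂ, ∃ m κ : Fin 3 → ℂ,
      star U * A * U = diagReMatrix m κ := by
  have hG : (A + A.conjTranspose).IsHermitian := by
    simpa using isHermitian_smul_add_conjTranspose 1 A
  set U : Matrix (Fin 3) (Fin 3) ℂ := ↑hG.eigenvectorUnitary with hU
  set B := star U * A * U with hB
  have hdiag : B + B.conjTranspose = Matrix.diagonal (RCLike.ofReal ∘ hG.eigenvalues) := by
    have hadd : B + B.conjTranspose = star U * (A + A.conjTranspose) * U := by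
      simp only [hB, star_mul, ← Matrix.star_eq_conjTranspose, star_star, mul_add,
        add_mul, mul_assoc]
    rw [hadd, ← hG.conjStarAlgAut_star_eigenvectorUnitary, Unitary.conjStarAlgAut_star_apply]
  have hoff : ∀ i j, i ≠ j → B i j = -star (B j i) := fun i j hij => by
    have := congrFun (congrFun hdiag i) j
    rw [Matrix.diagonal_apply_ne _ hij, Matrix.add_apply, Matrix.conjTranspose_apply] at this
    exact eq_neg_of_add_eq_zero_left this
  refine ⟨U, hG.eigenvectorUnitary.2, fun j => B j j,
    ![-Complex.I * B 1 2, -Complex.I * B 2 0, -Complex.I * B 0 1], ?_⟩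
  have hI : ∀ z : ℂ, Complex.I * (-Complex.I * z) = z := fun z => by
    rw [← mul_assoc, mul_neg, Complex.I_mul_I]; ring
  have hI' : ∀ z : ℂ, Complex.I * star (-Complex.I * z) = -star z := fun z => by
    rw [star_mul', star_neg, Complex.star_def, Complex.conj_I, neg_neg, ← mul_assoc,
      Complex.I_mul_I]; ring
  ext i j
  fin_cases i <;> fin_cases j <;>
    simp only [diagReMatrix, Fin.zero_eta, Fin.mk_one, Fin.reduceFinMk, Matrix.of_apply,
      Matrix.cons_val, hI, hI'] <;> first | rfl | exact hoff _ _ (by decide)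

/-- For the matrix `M = diagReMatrix m κ` the characteristic polynomial of `u M + ū M*` depends on
`κ` only through the `|κ j|²` and `Re (κ₀ κ₁ κ₂)`. -/
theorem det_scalar_sub_diagReMatrix (m κ : Fin 3 → ℂ) (u t : ℂ) :
    (Matrix.scalar (Fin 3) t -
      (u • diagReMatrix m κ + star u • (diagReMatrix m κ).conjTranspose)).det =
      ∏ j, (t - (u * m j + star u * star (m j))) -
        (Complex.I * (u - star u)) ^ 2 *
          ∑ j, (t - (u * m j + star u * star (m j))) * (κ j * star (κ j)) -
        (Complex.I * (u - star u)) ^ 3 * (κ 0 * κ 1 * κ 2 + star (κ 0 * κ 1 * κ 2)) := by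
  rw [Matrix.det_fin_three, Fin.prod_univ_three, Fin.sum_univ_three]
  simp only [diagReMatrix, Matrix.sub_apply, Matrix.add_apply, Matrix.smul_apply,
    Matrix.conjTranspose_apply, Matrix.of_apply, Matrix.cons_val, Matrix.scalar_apply,
    Matrix.diagonal_apply, Fin.isValue, smul_eq_mul, star_mul', Complex.star_def,
    Complex.conj_I, Complex.conj_conj]
  simp
  ring

/-- Replacing the off-diagonal parameters by real ones, without changing the numerical range. -/
theorem exists_real_diagReMatrix (m κ : Fin 3 → ℂ) :
    ∃ x : Fin 3 → ℝ, numericalRange (Matrix.toEuclideanCLM (n := Fin 3) (𝕜 := ℂ)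
        (diagReMatrix m κ)) =
      numericalRange (Matrix.toEuclideanCLM (n := Fin 3) (𝕜 := ℂ)
        (diagReMatrix m fun j => (x j : ℂ))) := by
  obtain ⟨d, hd, hd0, hda⟩ := exists_neg_sum_eq_zero_sum_mul_eq_zero fun j => (m j).re
  -- The slope of `s` compensates the change of `∑ (m j).im * pⱼ` in the cubic coefficient.
  obtain ⟨t, ht, hts⟩ := exists_sq_eq_prod (p := fun j => Complex.normSq (κ j)) (d := d)
    (s := (κ 0 * κ 1 * κ 2).re) ((∑ j, (m j).im * d j) / 2) (fun j => Complex.normSq_nonneg _) hd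
    (by
      rw [Fin.prod_univ_three, ← map_mul, ← map_mul, Complex.normSq_apply]
      nlinarith [sq_nonneg (κ 0 * κ 1 * κ 2).im])
  obtain ⟨x, hx, hxs⟩ := exists_sq_eq_mul_eq ht hts
  refine ⟨x, numericalRange_eq_of_charpoly_eq fun u => Polynomial.funext fun z => ?_⟩
  rw [Matrix.eval_charpoly, Matrix.eval_charpoly, det_scalar_sub_diagReMatrix,
    det_scalar_sub_diagReMatrix]
  have e1 : ∀ j, (x j : ℂ) * star (x j : ℂ) = κ j * star (κ j) + t * d j := fun j => by
    rw [Complex.star_def, Complex.mul_conj, Complex.mul_conj, Complex.normSq_ofReal, ← pow_two, hx]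
    push_cast
    ring
  have e2 : (x 0 * x 1 * x 2 : ℂ) + star (x 0 * x 1 * x 2 : ℂ) =
      (κ 0 * κ 1 * κ 2 + star (κ 0 * κ 1 * κ 2)) + t * ∑ j, ((m j).im * d j : ℂ) := by
    rw [Complex.star_def, Complex.add_conj, Complex.add_conj, ← Complex.ofReal_mul,
      ← Complex.ofReal_mul, hxs, Complex.ofReal_re]
    push_cast
    ring
  have hd0' : ∑ j, (d j : ℂ) = 0 := by exact_mod_cast hd0
  have hda' : ∑ j, ((m j).re * d j : ℂ) = 0 := by exact_mod_cast hda
  have hm : ∀ j, u * m j + star u * star (m j) =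
      (u + star u) * (m j).re + Complex.I * (u - star u) * (m j).im := fun j => by
    rw [Complex.star_def]
    conv_lhs => rw [← Complex.re_add_im (m j)]
    simp only [map_add, map_mul, Complex.conj_ofReal, Complex.conj_I]
    ring
  rw [e2]
  simp only [e1, hm]
  simp only [Fin.sum_univ_three] at hd0' hda' ⊢
  linear_combination (Complex.I * (u - star u)) ^ 2 * t * (z * hd0' - (u + star u) * hda')

/-! ### Common zeros of two quadratic forms on `ℝ³` -/

/-- Two traceless real quadratic forms, the first of them diagonal, have a common nonzero zero.
As `a₀` has the largest absolute value, the nonzero zeros of the diagonal form with `f₀ ≥ 0` contain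
the graph of a continuous function of `(f₁, f₂) ≠ 0`. This graph is connected, and the other form
averages to zero over its points `(1, ±1, ±1)`. -/
theorem exists_common_zero_aux {a₀ a₁ a₂ b₀ b₁ b₂ : ℝ} (x₀ x₁ x₂ : ℝ) (ha : a₀ + a₁ + a₂ = 0)
    (hb : b₀ + b₁ + b₂ = 0) (h₁ : |a₁| ≤ |a₀|) (h₂ : |a₂| ≤ |a₀|) :
    ∃ f₀ f₁ f₂ : ℝ, (f₁ ≠ 0 ∨ f₂ ≠ 0) ∧ a₀ * f₀ ^ 2 + a₁ * f₁ ^ 2 + a₂ * f₂ ^ 2 = 0 ∧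
      b₀ * f₀ ^ 2 + b₁ * f₁ ^ 2 + b₂ * f₂ ^ 2 +
        2 * (x₀ * f₁ * f₂ + x₁ * f₂ * f₀ + x₂ * f₀ * f₁) = 0 := by
  -- The diagonal form vanishes on the cone `f₀² = c₁ f₁² + c₂ f₂²`, also if it is the zero form.
  obtain ⟨c₁, c₂, hc₁, hc₂, hc, ha₁, ha₂⟩ : ∃ c₁ c₂ : ℝ, 0 ≤ c₁ ∧ 0 ≤ c₂ ∧ c₁ + c₂ = 1 ∧
      a₁ = -c₁ * a₀ ∧ a₂ = -c₂ * a₀ := by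
    by_cases h0 : a₀ = 0
    · rw [h0, abs_zero] at h₁ h₂
      exact ⟨1, 0, by simp, by simp, by simp, by simp [h0, abs_nonpos_iff.mp h₁],
        by simp [abs_nonpos_iff.mp h₂]⟩
    · refine ⟨-a₁ / a₀, -a₂ / a₀, ?_, ?_, ?_, by field_simp, by field_simp⟩
      · rw [show -a₁ / a₀ = 1 + a₂ / a₀ by field_simp; linarith]
        have : |a₂ / a₀| ≤ 1 := by rw [abs_div]; exact div_le_one_of_le₀ h₂ (abs_nonneg _)
        linarith [(abs_le.mp this).1]
      · rw [show -a₂ / a₀ = 1 + a₁ / a₀ by field_simp; linarith]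
        have : |a₁ / a₀| ≤ 1 := by rw [abs_div]; exact div_le_one_of_le₀ h₁ (abs_nonneg _)
        linarith [(abs_le.mp this).1]
      · field_simp
        linarith
  set r : ℝ × ℝ → ℝ := fun v => √(c₁ * v.1 ^ 2 + c₂ * v.2 ^ 2) with hr
  have hr2 : ∀ v, r v ^ 2 = c₁ * v.1 ^ 2 + c₂ * v.2 ^ 2 := fun v => Real.sq_sqrt (by positivity)
  set q : ℝ × ℝ → ℝ := fun v => b₀ * r v ^ 2 + b₁ * v.1 ^ 2 + b₂ * v.2 ^ 2 +
    2 * (x₀ * v.1 * v.2 + x₁ * v.2 * r v + x₂ * r v * v.1) with hq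
  have hqc : Continuous q := by fun_prop
  have hconn : IsPreconnected ({0}ᶜ : Set (ℝ × ℝ)) :=
    (isConnected_compl_singleton_of_one_lt_rank (by simp; norm_num) 0).isPreconnected
  have hr1 : ∀ v : ℝ × ℝ, v.1 ^ 2 = 1 → v.2 ^ 2 = 1 → r v = 1 := fun v h1 h2 => by
    simp [hr, h1, h2, hc]
  have hsum : q (1, 1) + q (1, -1) + q (-1, 1) + q (-1, -1) = 0 := by
    simp only [hq]
    rw [hr1 (1, 1) (by simp) (by simp), hr1 (1, -1) (by simp) (by simp),
      hr1 (-1, 1) (by simp) (by simp), hr1 (-1, -1) (by simp) (by simp)]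
    linear_combination 4 * hb
  obtain ⟨v, hv, hqv⟩ : ∃ v ∈ ({0}ᶜ : Set (ℝ × ℝ)), q v ≤ 0 := by
    by_contra! h
    linarith [h (1, 1) (by simp), h (1, -1) (by simp), h (-1, 1) (by simp), h (-1, -1) (by simp)]
  obtain ⟨w, hw, hqw⟩ : ∃ w ∈ ({0}ᶜ : Set (ℝ × ℝ)), 0 ≤ q w := by
    by_contra! h
    linarith [h (1, 1) (by simp), h (1, -1) (by simp), h (-1, 1) (by simp), h (-1, -1) (by simp)]
  obtain ⟨z, hz, hqz⟩ := hconn.intermediate_value hv hw hqc.continuousOn ⟨hqv, hqw⟩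
  refine ⟨r z, z.1, z.2, ?_, ?_, hqz⟩
  · by_contra! h
    exact hz (Prod.ext h.1 h.2)
  · rw [hr2, ha₁, ha₂]
    ring

theorem exists_common_zero {a b : Fin 3 → ℝ} (x : Fin 3 → ℝ) (ha : ∑ j, a j = 0)
    (hb : ∑ j, b j = 0) :
    ∃ f : Fin 3 → ℝ, f ≠ 0 ∧ ∑ j, a j * f j ^ 2 = 0 ∧
      ∑ j, b j * f j ^ 2 + 2 * (x 0 * f 1 * f 2 + x 1 * f 2 * f 0 + x 2 * f 0 * f 1) = 0 := by
  simp only [Fin.sum_univ_three] at ha hb ⊢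
  obtain ⟨i, hi⟩ := Finite.exists_max fun j => |a j|
  have hne : ∀ {f : Fin 3 → ℝ} (i j : Fin 3), f i ≠ 0 ∨ f j ≠ 0 → f ≠ 0 := by
    rintro f i j h rfl
    simp at h
  obtain rfl | rfl | rfl : i = 0 ∨ i = 1 ∨ i = 2 := by omega
  · obtain ⟨f₀, f₁, f₂, hf, h1, h2⟩ :=
      exists_common_zero_aux (x 0) (x 1) (x 2) ha hb (hi 1) (hi 2)
    exact ⟨![f₀, f₁, f₂], hne 1 2 hf, h1, h2⟩
  · obtain ⟨f₁, f₂, f₀, hf, h1, h2⟩ := exists_common_zero_aux (a₀ := a 1) (b₀ := b 1)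
      (a₁ := a 2) (b₁ := b 2) (a₂ := a 0) (b₂ := b 0) (x 1) (x 2) (x 0)
      (by linarith) (by linarith) (hi 2) (hi 0)
    refine ⟨![f₀, f₁, f₂], hne 2 0 hf, ?_, ?_⟩
    · exact Eq.trans (by simp only [Matrix.cons_val]; ring) h1
    · exact Eq.trans (by simp only [Matrix.cons_val]; ring) h2
  · obtain ⟨f₂, f₀, f₁, hf, h1, h2⟩ := exists_common_zero_aux (a₀ := a 2) (b₀ := b 2)
      (a₁ := a 0) (b₁ := b 0) (a₂ := a 1) (b₂ := b 1) (x 2) (x 0) (x 1)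
      (by linarith) (by linarith) (hi 0) (hi 1)
    refine ⟨![f₀, f₁, f₂], hne 0 1 hf, ?_, ?_⟩
    · exact Eq.trans (by simp only [Matrix.cons_val]; ring) h1
    · exact Eq.trans (by simp only [Matrix.cons_val]; ring) h2

/-- A real unit vector at which the complex symmetric form takes its mean value: the real and
imaginary parts of the traceless form have a common zero. -/
theorem exists_unit_vector_eq_trace_div (m : Fin 3 → ℂ) (x : Fin 3 → ℝ) :
    ∃ f : EuclideanSpace ℝ (Fin 3), ‖f‖ = 1 ∧
      ∑ i, ∑ j, (f i : ℂ) * diagReMatrix m (fun j => (x j : ℂ)) i j * f j =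
        (diagReMatrix m fun j => (x j : ℂ)).trace / 3 := by
  -- Subtracting the mean `τ` of the diagonal makes the form traceless.
  set τ : ℂ := (∑ j, m j) / 3 with hτ
  have hτ' : ∑ j, (m j - τ) = 0 := by
    simp only [hτ, Fin.sum_univ_three]; ring
  obtain ⟨g, hg, h1, h2⟩ := exists_common_zero (a := fun j => (m j - τ).re)
    (b := fun j => (m j - τ).im) x (by rw [← Complex.re_sum, hτ', Complex.zero_re])
    (by rw [← Complex.im_sum, hτ', Complex.zero_im])
  set G : EuclideanSpace ℝ (Fin 3) := WithLp.toLp 2 g with hG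
  have hG0 : ‖G‖ ≠ 0 := by
    rw [norm_ne_zero_iff]
    exact fun h => hg ((WithLp.toLp_eq_zero 2).mp h)
  have hn : (‖G‖ : ℂ) ^ 2 = ∑ j, (g j : ℂ) ^ 2 := by
    have : ‖G‖ ^ 2 = ∑ j, g j ^ 2 := by simp [EuclideanSpace.norm_sq_eq, hG]
    exact_mod_cast this
  refine ⟨‖G‖⁻¹ • G, by rw [norm_smul, norm_inv, norm_norm, inv_mul_cancel₀ hG0], ?_⟩
  have hform : ∑ j, (m j - τ) * (g j : ℂ) ^ 2 +
      2 * Complex.I * (x 0 * g 1 * g 2 + x 1 * g 2 * g 0 + x 2 * g 0 * g 1) = 0 := by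
    have e1 : ∑ j, ((m j - τ).re : ℂ) * (g j : ℂ) ^ 2 = 0 := by exact_mod_cast h1
    have e2 : ∑ j, ((m j - τ).im : ℂ) * (g j : ℂ) ^ 2 +
      2 * (x 0 * g 1 * g 2 + x 1 * g 2 * g 0 + x 2 * g 0 * g 1) = (0 : ℂ) := by exact_mod_cast h2
    have e3 : ∀ j, m j - τ = (m j - τ).re + (m j - τ).im * Complex.I := fun j =>
      (Complex.re_add_im _).symm
    simp only [Fin.sum_univ_three] at e1 e2 ⊢
    rw [e3 0, e3 1, e3 2]
    linear_combination e1 + Complex.I * e2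
  have hG0' : (‖G‖ : ℂ) ≠ 0 := by exact_mod_cast hG0
  have htr : (diagReMatrix m fun j => (x j : ℂ)).trace / 3 = τ := by
    simp [Matrix.trace_fin_three, diagReMatrix, hτ, Fin.sum_univ_three]
  rw [htr]
  simp only [Fin.sum_univ_three, diagReMatrix, PiLp.smul_apply, Matrix.of_apply,
    Matrix.cons_val, Complex.star_def, Complex.conj_ofReal, smul_eq_mul, Complex.ofReal_mul,
    Complex.ofReal_inv, hG] at hform hn hG0' ⊢
  field_simp
  linear_combination hform - τ * hn

/-! ### From complex symmetric matrices to Toeplitz matrices -/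

/-- A real unit vector is the middle column of a real orthogonal matrix, here with complex entries. -/
theorem exists_unitary_of_unit_vector {f : EuclideanSpace ℝ (Fin 3)} (hf : ‖f‖ = 1) :
    ∃ V ∈ Matrix.unitaryGroup (Fin 3) ℂ, star V = V.transpose ∧ ∀ i, V i 1 = f i := by
  have hv : Orthonormal ℝ (({1} : Set (Fin 3)).domRestrict fun _ => f) :=
    ⟨fun _ => hf, fun i j hij => absurd (Subsingleton.elim i j) hij⟩
  obtain ⟨b, hb⟩ := hv.exists_orthonormalBasis_extension_of_card_eq (by simp)
  have hstar : star (Matrix.of fun i j => (b j i : ℂ)) =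
      (Matrix.of fun i j => (b j i : ℂ)).transpose := by
    ext i j
    simp
  refine ⟨Matrix.of fun i j => (b j i : ℂ), ?_, hstar, fun i => by simp [hb 1 rfl]⟩
  rw [Matrix.mem_unitaryGroup_iff', hstar]
  ext i j
  have := orthonormal_iff_ite.mp b.orthonormal i j
  rw [PiLp.inner_apply] at this
  simp only [Matrix.mul_apply, Matrix.transpose_apply, Matrix.of_apply, Matrix.one_apply]
  rw [← Complex.ofReal_one, ← Complex.ofReal_zero, ← apply_ite Complex.ofReal, ← this]
  push_cast
  exact Finset.sum_congr rfl fun k _ => by simp [mul_comm]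

/-- If the middle diagonal entry of a complex symmetric matrix is the mean of the diagonal, then the
orthonormal basis `(e₀ + i e₂) / √2`, `e₁`, `(e₀ - i e₂) / √2` makes it a Toeplitz matrix. -/
theorem exists_unitary_conj_eq_toeplitz {S : Matrix (Fin 3) (Fin 3) ℂ} (hS : S.transpose = S)
    (h : S 1 1 = S.trace / 3) :
    ∃ U ∈ Matrix.unitaryGroup (Fin 3) ℂ, ∃ c : ℤ → ℂ,
      star U * S * U = Matrix.of fun i j : Fin 3 => c ((i : ℤ) - j) := by
  obtain ⟨r, hr, hrr⟩ : ∃ r : ℂ, star r = r ∧ r * r = 1 / 2 := by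
    refine ⟨((√2)⁻¹ : ℝ), Complex.conj_ofReal _, ?_⟩
    rw [← Complex.ofReal_mul, ← mul_inv, Real.mul_self_sqrt zero_le_two]
    norm_num
  set U : Matrix (Fin 3) (Fin 3) ℂ :=
    !![r, 0, r; 0, 1, 0; Complex.I * r, 0, -Complex.I * r] with hU
  have hstar : star U = !![r, 0, -Complex.I * r; 0, 1, 0; r, 0, Complex.I * r] := by
    have hr' : (starRingEnd ℂ) r = r := hr
    ext i j
    fin_cases i <;> fin_cases j <;> simp [hU, Matrix.star_apply, hr']
  refine ⟨U, ?_, fun k => if k = 0 then S 1 1 else if k = 1 then r * (S 1 0 + Complex.I * S 1 2)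
    else if k = -1 then r * (S 1 0 - Complex.I * S 1 2)
    else if k = 2 then (S 0 0 - S 2 2) / 2 + Complex.I * S 0 2
    else (S 0 0 - S 2 2) / 2 - Complex.I * S 0 2, ?_⟩
  · rw [Matrix.mem_unitaryGroup_iff', hstar, hU]
    ext i j
    fin_cases i <;> fin_cases j <;> simp [Matrix.mul_apply, Fin.sum_univ_three] <;>
      first
        | linear_combination 2 * hrr - r * r * Complex.I_mul_I
        | linear_combination r * r * Complex.I_mul_I
  · have s01 : S 0 1 = S 1 0 := congrFun (congrFun hS 1) 0
    have s02 : S 2 0 = S 0 2 := congrFun (congrFun hS 0) 2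
    have s12 : S 2 1 = S 1 2 := congrFun (congrFun hS 1) 2
    rw [Matrix.trace_fin_three] at h
    rw [hstar, hU]
    ext i j
    fin_cases i <;> fin_cases j <;>
      simp [Matrix.mul_apply, Matrix.vecMul, dotProduct, Fin.sum_univ_three, s01, s02, s12]
    · linear_combination (S 0 0 + S 2 2) * hrr - r * r * S 2 2 * Complex.I_mul_I - 3 / 2 * h
    · ring
    · linear_combination
        (S 0 0 - S 2 2 - 2 * Complex.I * S 0 2) * hrr + r * r * S 2 2 * Complex.I_mul_I
    · ring
    · ring
    · linear_combination
        (S 0 0 - S 2 2 + 2 * Complex.I * S 0 2) * hrr + r * r * S 2 2 * Complex.I_mul_I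
    · ring
    · linear_combination (S 0 0 + S 2 2) * hrr - r * r * S 2 2 * Complex.I_mul_I - 3 / 2 * h

theorem exists_toeplitz_numericalRange_eq (A : Matrix (Fin 3) (Fin 3) ℂ) :
    ∃ c : ℤ → ℂ, numericalRange (Matrix.toEuclideanCLM (n := Fin 3) (𝕜 := ℂ) A) =
      numericalRange (Matrix.toEuclideanCLM (n := Fin 3) (𝕜 := ℂ)
        (Matrix.of fun i j => c ((i : ℤ) - j))) := by
  obtain ⟨U, hU, m, κ, hUA⟩ := exists_unitary_conj_eq_diagReMatrix A
  obtain ⟨x, hx⟩ := exists_real_diagReMatrix m κ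
  obtain ⟨f, hf, hfS⟩ := exists_unit_vector_eq_trace_div m x
  obtain ⟨V, hV, hVstar, hVf⟩ := exists_unitary_of_unit_vector hf
  set S := diagReMatrix m fun j => (x j : ℂ) with hS
  have hSt : S.transpose = S := by
    ext i j
    fin_cases i <;> fin_cases j <;> simp [hS, diagReMatrix]
  obtain ⟨W, hW, c, hc⟩ := exists_unitary_conj_eq_toeplitz (S := star V * S * V)
    (by rw [Matrix.transpose_mul, Matrix.transpose_mul, hSt, hVstar, Matrix.transpose_transpose,
      mul_assoc])
    (by
      rw [Matrix.trace_mul_comm, ← mul_assoc, Matrix.mem_unitaryGroup_iff.mp hV, one_mul, ← hfS,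
        hVstar]
      simp only [Matrix.mul_apply, Matrix.transpose_apply, hVf, Finset.sum_mul]
      exact Finset.sum_comm)
  exact ⟨c, by rw [← hc, numericalRange_conj_unitary _ _ hW, numericalRange_conj_unitary _ _ hV,
    ← hx, ← hUA, numericalRange_conj_unitary _ _ hU]⟩

theorem mainTheorem8 (A : Matrix (Fin 3) (Fin 3) ℂ) :
    ∃ (θ : L2Circle) (g₁ g₂ : LinftyCircle),
      IsInner θ ∧ FiniteDimensional ℂ (modelSpace θ) ∧
      numericalRange (Matrix.toEuclideanCLM (n := Fin 3) (𝕜 := ℂ) A) =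
        numericalRange (opDirectSum (truncatedToeplitz θ g₁) (truncatedToeplitz θ g₂)) := by
  obtain ⟨c, hc⟩ := exists_toeplitz_numericalRange_eq A
  obtain ⟨g, hg⟩ := exists_symbol_of_toeplitz 3 c
  exact ⟨fourierLp 2 ((3 : ℕ) : ℤ), g, g, isInner_fourierLp (by omega),
    (modelBasis 3).toBasis.finiteDimensional_of_finite,
    by rw [numericalRange_opDirectSum_self, hg, hc]⟩
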